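/- Let $k\ge 4$ be an even integer and let $\gamma\ge 1$, $C>0$, $\sigma_1>0$ be real numbers. Then there is a constant $C_1=C_1(k,\gamma,C,\sigma_1)$, depending only on $k,\gamma,C,\sigma_1$, such that the following holds. Let $n\ge 2$, let $X_1,\dots,X_n$ be independent and identically distributed random variables with values in a measurable space $\mathcal X$, let $h:\mathcal X^2\to\mathbb R$ be measurable and symmetric, and let $$U_n(h)=\binom n2^{-1}\sum_{1\le i_1<i_2\le n}h(X_{i_1},X_{i_2})$$ be the U-statistic of degree $2$ with kernel $h$. Assume that $$\mathbb E\bigl[|h(X_1,X_2)|^j\bigr]\le C^j\,(j!)^{\gamma}\qquad\text{for all integers } j\ge 3,$$ and that $U_n(h)$ is non-degenerate with $\mathbb V[h_1(X_1)]=\sigma_1^2>0$, where $h_1(x)=\mathbb E[h(x,X_2)]$. Then $\mathbb V(U_n(h))>0$, the standardised statistic $$Z_n=\frac{U_n(h)-\mathbb E\,U_n(h)}{\sqrt{\mathbb V(U_n(h))}}$$ has a finite $k$-th moment, and $$\bigl|\mathbb E(Z_n^k)-\mathbb E(N^k)\bigr|\le \frac{C_1}{n},$$ where $N$ is a standard normal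 random variable. -/

import Mathlib

open MeasureTheory ProbabilityTheory

noncomputable section

/-- The U-statistic of degree `2` with kernel `h` based on the sample `X 0, …, X (n - 1)`:
the average of `h (X i) (X j)` over the pairs of indices `i < j`. -/
def uStatistic {Ω 𝒳 : Type*} {n : ℕ} (h : 𝒳 → 𝒳 → ℝ) (X : Fin n → Ω → 𝒳) (ω : Ω) : ℝ :=
  ((n.choose 2 : ℕ) : ℝ)⁻¹ *
    ∑ p : Fin n × Fin n with p.1 < p.2, h (X p.1 ω) (X p.2 ω)

/-- The first projection of the kernel, `h₁ x = 𝔼[h x Y]`, where `Y` has the law of an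
observation. -/
def kernelProjection {Ω 𝒳 : Type*} [MeasurableSpace Ω] (h : 𝒳 → 𝒳 → ℝ) (Y : Ω → 𝒳)
    (P : Measure Ω) (x : 𝒳) : ℝ :=
  ∫ ω, h x (Y ω) ∂P

/-- The standardisation `(U - 𝔼 U) / √(𝕍 U)` of a real random variable `U`. -/
def standardised {Ω : Type*} [MeasurableSpace Ω] (U : Ω → ℝ) (P : Measure Ω) (ω : Ω) : ℝ :=
  (U ω - ∫ ω', U ω' ∂P) / √(variance U P)

end

/-! The proof is a moment method. Let `S` be the sum of `f (X i, X j)` over `i < j`, where `f` is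
the kernel minus its mean, and let `V = 𝔼 S²`. Then `Z_n = S / √V`. Expanding `𝔼 S^(2r+2)` gives a
sum over words of `2r + 2` pairs, read as multigraphs on the set of indices. Subtract from each
mixed moment the first Wick step, in which one fixed edge is paired with every other edge. The
remainders (`pairingDefect`) add up to `𝔼 S^(2r+2) - (2r+1) V 𝔼 S^(2r)`.

A remainder vanishes if some edge is isolated, by centring and independence. It also vanishes on
disjoint unions of two-edge paths, where exactly one pairing survives and factorises exactly. By a
degree count (`exists_partner`), every other graph has fewer than `3(r+1)` vertices, so the
remainders total `O(n^(3r+2))`.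

Non-degeneracy gives `V ≥ c n³`, by comparing `S` with its projection on single observations
(`le_integral_sum_pairFamily_sq`). After division by `V^(r+1)` the moments obey the Gaussian
recursion `m_(2r+2) = (2r+1) m_(2r)` up to `O(1/n)`, and induction on `r` concludes
(`abs_normalised_moment_sub_le`). -/

/-! ### Counting maps with few values -/

/-- The number of maps into `Fin n` taking at most `v` values is at most `v ^ #ι * n ^ v`. -/
theorem card_filter_card_image_le {ι : Type*} [Fintype ι] [DecidableEq ι] {n : ℕ} (hn : 0 < n)
    (v : ℕ) :
    (Finset.univ.filter fun u : ι → Fin n => (Finset.univ.image u).card ≤ v).card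
      ≤ v ^ Fintype.card ι * n ^ v := by
  classical
  have hsub : (Finset.univ.filter fun u : ι → Fin n => (Finset.univ.image u).card ≤ v) ⊆
      Finset.univ.image fun ab : (ι → Fin v) × (Fin v → Fin n) => ab.2 ∘ ab.1 := by
    intro u hu
    have hu' : (Finset.univ.image u).card ≤ v := (Finset.mem_filter.1 hu).2
    obtain ⟨e⟩ : Nonempty ({x // x ∈ Finset.univ.image u} ↪ Fin v) :=
      Function.Embedding.nonempty_of_card_le (by rwa [Fintype.card_coe, Fintype.card_fin])
    -- The map factors through an injective labelling of its values. The default value `⟨0, hn⟩` is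
    -- taken only at unused labels.
    refine Finset.mem_image.2 ⟨⟨fun i => e ⟨u i, Finset.mem_image_of_mem u (Finset.mem_univ i)⟩,
      Function.extend e Subtype.val fun _ => ⟨0, hn⟩⟩, Finset.mem_univ _, ?_⟩
    funext i
    simp only [Function.comp_apply]
    rw [e.injective.extend_apply]
  refine (Finset.card_le_card hsub).trans (Finset.card_image_le.trans ?_)
  simp

/-! ### Multigraphs: degrees and number of vertices -/

section Multigraph

variable {ι V : Type*}

/-- The two endpoints of each edge of the multigraph `w`. -/
def endpoints (w : ι → V × V) (q : ι × Bool) : V :=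
  if q.2 then (w q.1).1 else (w q.1).2

/-- The edges `i` and `j` of the multigraph `w` have a common endpoint. -/
def Touches (w : ι → V × V) (i j : ι) : Prop :=
  ∃ a b : Bool, endpoints w (i, a) = endpoints w (j, b)

theorem endpoints_injective : Function.Injective (endpoints : (ι → V × V) → ι × Bool → V) := by
  intro w w' h
  funext i
  have h1 := congrFun h (i, true)
  have h2 := congrFun h (i, false)
  simp only [endpoints, if_true, Bool.false_eq_true, if_false] at h1 h2
  exact Prod.ext h1 h2

variable [Fintype ι] [DecidableEq V]

/-- The set of vertices of the multigraph `w`. -/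
def vertexSet (w : ι → V × V) : Finset V := Finset.univ.image (endpoints w)

/-- The degree of an endpoint in the multigraph `w`. -/
def endDegree (w : ι → V × V) (q : ι × Bool) : ℕ :=
  (Finset.univ.filter fun q' => endpoints w q' = endpoints w q).card

theorem endDegree_pos (w : ι → V × V) (q : ι × Bool) : 1 ≤ endDegree w q :=
  Finset.card_pos.2 ⟨q, by simp⟩

theorem two_le_endDegree [DecidableEq ι] {w : ι → V × V} {q q' : ι × Bool} (hne : q ≠ q')
    (h : endpoints w q = endpoints w q') : 2 ≤ endDegree w q := by
  have : ({q, q'} : Finset (ι × Bool)) ⊆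
      Finset.univ.filter fun r => endpoints w r = endpoints w q := by
    intro r hr
    rcases Finset.mem_insert.1 hr with rfl | hr
    · simp
    · rw [Finset.mem_singleton.1 hr]; simp [h]
  exact (Finset.card_pair hne).ge.trans (Finset.card_le_card this)

theorem three_le_endDegree [DecidableEq ι] {w : ι → V × V} {q q' q'' : ι × Bool} (h1 : q ≠ q') (h2 : q ≠ q'')
    (h3 : q' ≠ q'') (h : endpoints w q = endpoints w q') (h' : endpoints w q = endpoints w q'') :
    3 ≤ endDegree w q := by
  have : ({q, q', q''} : Finset (ι × Bool)) ⊆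
      Finset.univ.filter fun r => endpoints w r = endpoints w q := by
    intro r hr
    simp only [Finset.mem_insert, Finset.mem_singleton] at hr
    refine Finset.mem_filter.2 ⟨Finset.mem_univ _, ?_⟩
    rcases hr with rfl | rfl | rfl
    exacts [rfl, h.symm, h'.symm]
  have hc : ({q, q', q''} : Finset (ι × Bool)).card = 3 := by
    rw [Finset.card_eq_three]; exact ⟨q, q', q'', h1, h2, h3, rfl⟩
  exact hc.ge.trans (Finset.card_le_card this)

/-- A vertex of degree `d` is hit by `d` endpoints, each of weight `1 / d`, so it counts once in
total. -/
theorem sum_inv_endDegree (w : ι → V × V) :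
    ∑ i, ((endDegree w (i, true) : ℚ)⁻¹ + (endDegree w (i, false) : ℚ)⁻¹)
      = (vertexSet w).card := by
  have h1 : ∑ q : ι × Bool, ((endDegree w q : ℕ) : ℚ)⁻¹ = (vertexSet w).card := by
    have := Finset.sum_comp (s := Finset.univ)
      (fun v : V => (((Finset.univ.filter fun q' => endpoints w q' = v).card : ℕ) : ℚ)⁻¹)
      (endpoints w)
    refine this.trans ?_
    rw [vertexSet, Finset.card_eq_sum_ones, Nat.cast_sum]
    refine Finset.sum_congr rfl fun v hv => ?_
    obtain ⟨q, -, rfl⟩ := Finset.mem_image.1 hv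
    have hpos := endDegree_pos w q
    unfold endDegree at hpos
    rw [nsmul_eq_mul, mul_inv_cancel₀ (by positivity)]
    simp
  rw [← h1, Fintype.sum_prod_type]
  simp

theorem inv_add_inv_le {a b : ℕ} (ha : 1 ≤ a) (hb : 1 ≤ b) (h : 2 ≤ a ∨ 2 ≤ b) :
    (a : ℚ)⁻¹ + (b : ℚ)⁻¹ ≤ 3 / 2 := by
  have key : ∀ c d : ℕ, 2 ≤ c → 1 ≤ d → (c : ℚ)⁻¹ + (d : ℚ)⁻¹ ≤ 3 / 2 := by
    intro c d hc hd
    have h1 : (c : ℚ)⁻¹ ≤ 2⁻¹ := inv_anti₀ (by norm_num) (by exact_mod_cast hc)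
    have h2 : (d : ℚ)⁻¹ ≤ 1 := inv_le_one_of_one_le₀ (by exact_mod_cast hd)
    linarith
  rcases h with h | h
  · exact key a b h hb
  · rw [add_comm]; exact key b a h ha

theorem inv_add_inv_lt {a b : ℕ} (ha : 1 ≤ a) (hb : 1 ≤ b) (h : (2 ≤ a ∧ 2 ≤ b) ∨ 3 ≤ a ∨ 3 ≤ b) :
    (a : ℚ)⁻¹ + (b : ℚ)⁻¹ < 3 / 2 := by
  have key : ∀ c d : ℕ, 3 ≤ c → 1 ≤ d → (c : ℚ)⁻¹ + (d : ℚ)⁻¹ < 3 / 2 := by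
    intro c d hc hd
    have h1 : (c : ℚ)⁻¹ ≤ 3⁻¹ := inv_anti₀ (by norm_num) (by exact_mod_cast hc)
    have h2 : (d : ℚ)⁻¹ ≤ 1 := inv_le_one_of_one_le₀ (by exact_mod_cast hd)
    linarith
  rcases h with ⟨h, h'⟩ | h | h
  · have h1 : (a : ℚ)⁻¹ ≤ 2⁻¹ := inv_anti₀ (by norm_num) (by exact_mod_cast h)
    have h2 : (b : ℚ)⁻¹ ≤ 2⁻¹ := inv_anti₀ (by norm_num) (by exact_mod_cast h')
    linarith
  · exact key a b h hb
  · rw [add_comm]; exact key b a h ha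

/-- The endpoint shared with another edge has degree at least 2, so the weights are at most `1 / 2`
and `1`. -/
theorem inv_endDegree_le [DecidableEq ι] {w : ι → V × V} {i : ι} (h : ∃ j, j ≠ i ∧ Touches w i j) :
    (endDegree w (i, true) : ℚ)⁻¹ + (endDegree w (i, false) : ℚ)⁻¹ ≤ 3 / 2 := by
  obtain ⟨j, hj, a, b, hab⟩ := h
  have h2 : 2 ≤ endDegree w (i, a) :=
    two_le_endDegree (fun h => hj (congrArg Prod.fst h).symm) hab
  refine inv_add_inv_le (endDegree_pos _ _) (endDegree_pos _ _) ?_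
  cases a
  · exact Or.inr h2
  · exact Or.inl h2

/-- A multigraph without isolated edges and with at least `3 / 2` times as many vertices as edges
is a disjoint union of paths with two edges. -/
theorem exists_partner [DecidableEq ι] {w : ι → V × V} (hiso : ∀ i, ∃ j, j ≠ i ∧ Touches w i j)
    (hcard : 3 * Fintype.card ι ≤ 2 * (vertexSet w).card) (i : ι) :
    ∃ j, j ≠ i ∧ ∀ l, l ≠ i → l ≠ j → ¬ Touches w i l ∧ ¬ Touches w j l := by
  -- The weights add up to the number of vertices, which is at least `3 / 2` per edge, so the
  -- edgewise bound `3 / 2` is attained at every edge. This forces one endpoint of degree 2 and one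
  -- of degree 1.
  have heq : ∀ i, (endDegree w (i, true) : ℚ)⁻¹ + (endDegree w (i, false) : ℚ)⁻¹ = 3 / 2 := by
    have hle := fun i (_ : i ∈ Finset.univ) => inv_endDegree_le (hiso i)
    have hs : ∑ i, ((endDegree w (i, true) : ℚ)⁻¹ + (endDegree w (i, false) : ℚ)⁻¹)
        = ∑ _i : ι, (3 / 2 : ℚ) := by
      refine le_antisymm (Finset.sum_le_sum hle) ?_
      rw [sum_inv_endDegree, Finset.sum_const, Finset.card_univ, nsmul_eq_mul]
      have : (3 * Fintype.card ι : ℚ) ≤ 2 * (vertexSet w).card := by exact_mod_cast hcard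
      linarith
    exact fun i => (Finset.sum_eq_sum_iff_of_le hle).1 hs i (Finset.mem_univ i)
  have hside : ∀ i a b, 2 ≤ endDegree w (i, a) → 2 ≤ endDegree w (i, b) → a = b := by
    intro i a b ha hb
    by_contra hab
    refine absurd (heq i) (inv_add_inv_lt (endDegree_pos _ _) (endDegree_pos _ _) (Or.inl ?_)).ne
    cases a <;> cases b <;> simp_all
  have hdeg : ∀ q, endDegree w q < 3 := by
    rintro ⟨i, a⟩
    by_contra hq
    push Not at hq
    refine absurd (heq i) (inv_add_inv_lt (endDegree_pos _ _) (endDegree_pos _ _) (Or.inr ?_)).ne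
    cases a <;> simp_all
  have hne : ∀ {i j : ι} {a b : Bool}, i ≠ j → (i, a) ≠ (j, b) :=
    fun hij h => hij (congrArg Prod.fst h)
  obtain ⟨j, hj, a, b, hab⟩ := hiso i
  refine ⟨j, hj, fun l hli hlj => ⟨?_, ?_⟩⟩
  -- A third edge could only attach at the endpoint already shared by `i` and `j`, whose degree
  -- would become 3.
  · rintro ⟨c, d, hcd⟩
    obtain rfl := hside i a c (two_le_endDegree (hne hj.symm) hab)
      (two_le_endDegree (hne hli.symm) hcd)
    exact absurd (three_le_endDegree (hne hj.symm) (hne hli.symm) (hne hlj.symm) hab hcd)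
      (hdeg _).not_ge
  · rintro ⟨c, d, hcd⟩
    obtain rfl := hside j b c (two_le_endDegree (hne hj) hab.symm)
      (two_le_endDegree (hne hlj.symm) hcd)
    exact absurd (three_le_endDegree (hne hj) (hne hlj.symm) (hne hli.symm) hab.symm hcd)
      (hdeg _).not_ge

end Multigraph

/-! ### Sums over multigraphs with few vertices -/

theorem card_filter_card_vertexSet_le {ι : Type*} [Fintype ι] [DecidableEq ι] {n : ℕ} (hn : 0 < n)
    (v : ℕ) :
    (Finset.univ.filter fun w : ι → Fin n × Fin n => (vertexSet w).card ≤ v).card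
      ≤ v ^ (2 * Fintype.card ι) * n ^ v := by
  classical
  have h := card_filter_card_image_le (ι := ι × Bool) hn v
  rw [Fintype.card_prod, Fintype.card_bool, mul_comm (Fintype.card ι)] at h
  refine le_trans (Finset.card_le_card_of_injOn endpoints ?_ endpoints_injective.injOn) h
  intro w hw
  exact Finset.mem_coe.2 (Finset.mem_filter.2 ⟨Finset.mem_univ _, (Finset.mem_filter.1 hw).2⟩)

/-- A function on multigraphs with vertices in `Fin n` which is bounded by `K` and vanishes on
multigraphs with more than `v` vertices has a sum of order `n ^ v`. -/
theorem abs_sum_le_of_support {ι : Type*} [Fintype ι] [DecidableEq ι] {n : ℕ} (hn : 0 < n)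
    (v : ℕ) {F : (ι → Fin n × Fin n) → ℝ} {K : ℝ} (hK : ∀ w, |F w| ≤ K)
    (hF : ∀ w, F w ≠ 0 → (vertexSet w).card ≤ v) :
    |∑ w, F w| ≤ K * v ^ (2 * Fintype.card ι) * n ^ v := by
  classical
  have hK0 : 0 ≤ K := (abs_nonneg _).trans (hK fun _ => (⟨0, hn⟩, ⟨0, hn⟩))
  have hs : ∑ w, F w = ∑ w with (vertexSet w).card ≤ v, F w := by
    symm
    refine Finset.sum_subset (Finset.filter_subset _ _) fun w _ hw => ?_
    by_contra h
    exact hw (by simpa using hF w h)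
  rw [hs]
  refine (Finset.abs_sum_le_sum_abs _ _).trans ((Finset.sum_le_card_nsmul _ _ K
    fun w _ => hK w).trans ?_)
  rw [nsmul_eq_mul, mul_comm, mul_assoc]
  refine mul_le_mul_of_nonneg_left ?_ hK0
  exact_mod_cast card_filter_card_vertexSet_le (ι := ι) hn v

/-! ### Mixed moments and the Wick recursion -/

section MixedMoments

variable {Ω ι E : Type*} [MeasurableSpace Ω]

/-- The mixed moment `𝔼 ∏_{i ∈ A} Y (w i)` of a family of random variables `Y`. -/
noncomputable def mixedMoment (P : Measure Ω) (Y : E → Ω → ℝ) (w : ι → E) (A : Finset ι) : ℝ :=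
  ∫ ω, ∏ i ∈ A, Y (w i) ω ∂P

variable [Fintype ι] [DecidableEq ι]

theorem sum_prod_mul_prod_compl [Fintype E] (a b : E → ℝ) (A : Finset ι) :
    ∑ w : ι → E, (∏ i ∈ A, a (w i)) * ∏ i ∈ Aᶜ, b (w i)
      = (∑ e, a e) ^ A.card * (∑ e, b e) ^ Aᶜ.card := by
  classical
  have h := Finset.prod_univ_sum (fun _ : ι => (Finset.univ : Finset E))
    fun i e => if i ∈ A then a e else b e
  rw [Fintype.piFinset_univ] at h
  have hsplit : ∀ f : ι → ℝ, ∏ i, f i = (∏ i ∈ A, f i) * ∏ i ∈ Aᶜ, f i := fun f =>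
    (Finset.prod_mul_prod_compl A f).symm
  have hA : ∀ f g : ι → ℝ, ∏ i ∈ A, (if i ∈ A then f i else g i) = ∏ i ∈ A, f i := fun f g =>
    Finset.prod_congr rfl fun i hi => if_pos hi
  have hB : ∀ f g : ι → ℝ, ∏ i ∈ Aᶜ, (if i ∈ A then f i else g i) = ∏ i ∈ Aᶜ, g i := fun f g =>
    Finset.prod_congr rfl fun i hi => if_neg (Finset.mem_compl.1 hi)
  calc ∑ w : ι → E, (∏ i ∈ A, a (w i)) * ∏ i ∈ Aᶜ, b (w i)
      = ∑ w : ι → E, ∏ i, (if i ∈ A then a (w i) else b (w i)) := by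
        refine Finset.sum_congr rfl fun w _ => ?_
        rw [hsplit, hA, hB]
    _ = ∏ i, ∑ e, (if i ∈ A then a e else b e) := h.symm
    _ = ∏ i, (if i ∈ A then ∑ e, a e else ∑ e, b e) := by
        refine Finset.prod_congr rfl fun i _ => ?_
        split_ifs <;> rfl
    _ = _ := by rw [hsplit, hA, hB, Finset.prod_const, Finset.prod_const]

/-- Writing the product of two moments as an iterated integral, with separate variables for `A` and
its complement, lets the sum over words factor pointwise. -/
theorem sum_mixedMoment_mul_compl [Fintype E] {P : Measure Ω} {Y : E → Ω → ℝ}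
    (hint : ∀ (w : ι → E) (A : Finset ι), Integrable (fun ω => ∏ i ∈ A, Y (w i) ω) P)
    (A : Finset ι) :
    ∑ w : ι → E, mixedMoment P Y w A * mixedMoment P Y w Aᶜ
      = (∫ ω, (∑ e, Y e ω) ^ A.card ∂P) * ∫ ω, (∑ e, Y e ω) ^ Aᶜ.card ∂P := by
  have h1 : ∀ y, ∑ w : ι → E, mixedMoment P Y w A * ∏ i ∈ Aᶜ, Y (w i) y
      = (∫ ω, (∑ e, Y e ω) ^ A.card ∂P) * (∑ e, Y e y) ^ Aᶜ.card := by
    intro y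
    simp_rw [mixedMoment, ← integral_mul_const]
    rw [← integral_finsetSum _ fun w _ => (hint w A).mul_const _]
    exact integral_congr_ae (Filter.Eventually.of_forall fun x =>
      sum_prod_mul_prod_compl (fun e => Y e x) (fun e => Y e y) A)
  calc ∑ w : ι → E, mixedMoment P Y w A * mixedMoment P Y w Aᶜ
      = ∑ w : ι → E, ∫ y, mixedMoment P Y w A * ∏ i ∈ Aᶜ, Y (w i) y ∂P :=
        Finset.sum_congr rfl fun w _ => (integral_const_mul _ _).symm
    _ = ∫ y, ∑ w : ι → E, mixedMoment P Y w A * ∏ i ∈ Aᶜ, Y (w i) y ∂P :=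
        (integral_finsetSum _ fun w _ => (hint w Aᶜ).const_mul _).symm
    _ = _ := by simp_rw [h1, integral_const_mul]

/-- The difference between a mixed moment and the first step of its Wick expansion, in which
the factor at `i₀` is paired with each of the other factors. -/
noncomputable def pairingDefect (P : Measure Ω) (Y : E → Ω → ℝ) (i₀ : ι) (w : ι → E) : ℝ :=
  mixedMoment P Y w Finset.univ
    - ∑ j ∈ Finset.univ.erase i₀, mixedMoment P Y w {i₀, j} * mixedMoment P Y w {i₀, j}ᶜ

/-- Every choice of partner for `i₀` contributes the same product of total moments, which produces
the Gaussian coefficient `card ι - 1`. -/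
theorem sum_pairingDefect [Fintype E] {P : Measure Ω} [IsProbabilityMeasure P] {Y : E → Ω → ℝ}
    (hint : ∀ (w : ι → E) (A : Finset ι), Integrable (fun ω => ∏ i ∈ A, Y (w i) ω) P) (i₀ : ι) :
    ∑ w : ι → E, pairingDefect P Y i₀ w
      = ∫ ω, (∑ e, Y e ω) ^ Fintype.card ι ∂P
        - (Fintype.card ι - 1 : ℕ) * ((∫ ω, (∑ e, Y e ω) ^ 2 ∂P)
          * ∫ ω, (∑ e, Y e ω) ^ (Fintype.card ι - 2) ∂P) := by
  have h1 : ∑ w : ι → E, mixedMoment P Y w Finset.univ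
      = ∫ ω, (∑ e, Y e ω) ^ Fintype.card ι ∂P := by
    have := sum_mixedMoment_mul_compl hint Finset.univ
    simpa [mixedMoment] using this
  unfold pairingDefect
  rw [Finset.sum_sub_distrib, h1, Finset.sum_comm]
  congr 1
  have h2 : ∀ j ∈ Finset.univ.erase i₀,
      ∑ w : ι → E, mixedMoment P Y w {i₀, j} * mixedMoment P Y w {i₀, j}ᶜ
        = (∫ ω, (∑ e, Y e ω) ^ 2 ∂P) * ∫ ω, (∑ e, Y e ω) ^ (Fintype.card ι - 2) ∂P := by
    intro j hj
    rw [sum_mixedMoment_mul_compl hint, Finset.card_compl,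
      Finset.card_pair (Finset.ne_of_mem_erase hj).symm]
  rw [Finset.sum_congr rfl h2, Finset.sum_const, Finset.card_erase_of_mem (Finset.mem_univ _),
    Finset.card_univ, nsmul_eq_mul]

variable {V : Type*} [DecidableEq V]

/-- An isolated edge lies in one factor of every term and brings in a zero mean. Without isolated
edges but with many vertices, `i₀` touches only its partner: the other pairings vanish by centring,
and the partner's term equals the full mixed moment. -/
theorem two_mul_card_vertexSet_lt_of_pairingDefect_ne_zero {P : Measure Ω} {Y : V × V → Ω → ℝ}
    (hzero : ∀ (w : ι → V × V) i, mixedMoment P Y w {i} = 0)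
    (hfac : ∀ (w : ι → V × V) (A B : Finset ι), (∀ i ∈ A, ∀ j ∈ B, ¬ Touches w i j) →
      mixedMoment P Y w (A ∪ B) = mixedMoment P Y w A * mixedMoment P Y w B)
    {i₀ : ι} {w : ι → V × V} (hw : pairingDefect P Y i₀ w ≠ 0) :
    2 * (vertexSet w).card < 3 * Fintype.card ι := by
  by_contra hcard
  push Not at hcard
  refine hw ?_
  unfold pairingDefect
  by_cases hiso : ∀ i, ∃ j, j ≠ i ∧ Touches w i j
  · obtain ⟨j, hj, hsep⟩ := exists_partner hiso hcard i₀
    rw [Finset.sum_eq_single_of_mem j (Finset.mem_erase.2 ⟨hj, Finset.mem_univ _⟩)]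
    · rw [← hfac, Finset.union_compl, sub_self]
      intro i hi l hl
      simp only [Finset.mem_compl, Finset.mem_insert, Finset.mem_singleton, not_or] at hi hl
      rcases hi with rfl | rfl
      · exact (hsep l hl.1 hl.2).1
      · exact (hsep l hl.1 hl.2).2
    · intro l hl hlj
      have h := hfac w {i₀} {l} fun i hi l' hl' => by
        rw [Finset.mem_singleton.1 hi, Finset.mem_singleton.1 hl']
        exact (hsep l (Finset.ne_of_mem_erase hl) hlj).1
      rw [Finset.insert_eq, h, hzero, zero_mul, zero_mul]
  · push Not at hiso
    obtain ⟨i, hi⟩ := hiso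
    have hvan : ∀ A : Finset ι, i ∈ A → mixedMoment P Y w A = 0 := by
      intro A hA
      have h := hfac w {i} (A.erase i) fun i' hi' l hl => by
        rw [Finset.mem_singleton.1 hi']
        exact hi l (Finset.ne_of_mem_erase hl)
      rw [← Finset.insert_eq, Finset.insert_erase hA] at h
      rw [h, hzero, zero_mul]
    rw [hvan _ (Finset.mem_univ i), zero_sub, neg_eq_zero]
    refine Finset.sum_eq_zero fun j _ => ?_
    by_cases hij : i ∈ ({i₀, j} : Finset ι)
    · rw [hvan _ hij, zero_mul]
    · rw [hvan _ (Finset.mem_compl.2 hij), mul_zero]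

theorem abs_pairingDefect_le {P : Measure Ω} {Y : E → Ω → ℝ} {K : ℝ}
    (hK : ∀ (w : ι → E) (A : Finset ι), |mixedMoment P Y w A| ≤ K) (i₀ : ι) (w : ι → E) :
    |pairingDefect P Y i₀ w| ≤ K + Fintype.card ι * K ^ 2 := by
  have hK0 : 0 ≤ K := (abs_nonneg _).trans (hK w ∅)
  refine (abs_sub _ _).trans (add_le_add (hK _ _) ?_)
  refine (Finset.abs_sum_le_sum_abs _ _).trans ((Finset.sum_le_card_nsmul _ _ (K ^ 2)
    fun j _ => ?_).trans ?_)
  · rw [abs_mul, sq]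
    exact mul_le_mul (hK _ _) (hK _ _) (abs_nonneg _) hK0
  · rw [nsmul_eq_mul]
    refine mul_le_mul_of_nonneg_right ?_ (sq_nonneg K)
    exact_mod_cast Finset.card_le_univ _

/-- For a centred family indexed by pairs of vertices, in which families of pairs without common
vertices are uncorrelated, the even moments of the total satisfy the recursion of Gaussian moments
up to an error of lower order. -/
theorem abs_integral_sum_pow_sub_le {P : Measure Ω} [IsProbabilityMeasure P] {n : ℕ} (hn : 0 < n)
    {Y : Fin n × Fin n → Ω → ℝ} {r : ℕ} {K : ℝ}
    (hint : ∀ (w : Fin (2 * (r + 1)) → Fin n × Fin n) (A : Finset (Fin (2 * (r + 1)))),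
      Integrable (fun ω => ∏ i ∈ A, Y (w i) ω) P)
    (hK : ∀ (w : Fin (2 * (r + 1)) → Fin n × Fin n) (A : Finset (Fin (2 * (r + 1)))),
      |mixedMoment P Y w A| ≤ K)
    (hzero : ∀ (w : Fin (2 * (r + 1)) → Fin n × Fin n) i, mixedMoment P Y w {i} = 0)
    (hfac : ∀ (w : Fin (2 * (r + 1)) → Fin n × Fin n) (A B : Finset (Fin (2 * (r + 1)))),
      (∀ i ∈ A, ∀ j ∈ B, ¬ Touches w i j) →
      mixedMoment P Y w (A ∪ B) = mixedMoment P Y w A * mixedMoment P Y w B) :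
    |∫ ω, (∑ e, Y e ω) ^ (2 * (r + 1)) ∂P
        - (2 * r + 1) * ((∫ ω, (∑ e, Y e ω) ^ 2 ∂P) * ∫ ω, (∑ e, Y e ω) ^ (2 * r) ∂P)|
      ≤ (K + (2 * (r + 1) : ℕ) * K ^ 2) * (3 * r + 2 : ℕ) ^ (2 * (2 * (r + 1)))
        * n ^ (3 * r + 2) := by
  have hsum := sum_pairingDefect hint ⟨0, by omega⟩
  rw [Fintype.card_fin, show 2 * (r + 1) - 1 = 2 * r + 1 by omega,
    show 2 * (r + 1) - 2 = 2 * r by omega] at hsum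
  push_cast at hsum
  rw [← hsum]
  -- `2v < 6(r+1)` means `v ≤ 3r + 2`, a whole power of `n` below the main order `n^(3(r+1))`. This
  -- is the source of the rate `1 / n`.
  have h := abs_sum_le_of_support hn (3 * r + 2)
    (F := pairingDefect P Y (⟨0, by omega⟩ : Fin (2 * (r + 1))))
    (fun w => abs_pairingDefect_le hK _ w) fun w hw => by
      have := two_mul_card_vertexSet_lt_of_pairingDefect_ne_zero hzero hfac hw
      rw [Fintype.card_fin] at this
      omega
  rwa [Fintype.card_fin] at h

end MixedMoments

/-! ### Gaussian moments and the induction on the order -/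

theorem integrable_pow_mul_exp_neg_sq_div_two (m : ℕ) :
    Integrable fun x : ℝ => x ^ m * Real.exp (-(x ^ 2 / 2)) := by
  have h := integrable_rpow_mul_exp_neg_mul_sq (b := 1 / 2) (by norm_num) (s := m)
    (by have : (0 : ℝ) ≤ m := m.cast_nonneg
        linarith)
  refine h.congr (Filter.Eventually.of_forall fun x => ?_)
  simp only [Real.rpow_natCast]
  congr 2
  ring

theorem integral_pow_gaussianReal_zero_one (m : ℕ) :
    ∫ x, x ^ m ∂(gaussianReal 0 1)
      = (√(2 * Real.pi))⁻¹ * ∫ x : ℝ, x ^ m * Real.exp (-(x ^ 2 / 2)) := by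
  rw [integral_gaussianReal_eq_integral_smul one_ne_zero, ← integral_const_mul]
  refine integral_congr_ae (Filter.Eventually.of_forall fun x => ?_)
  simp only [gaussianPDFReal, smul_eq_mul, NNReal.coe_one, mul_one, sub_zero, neg_div]
  ring

/-- The recursion for the moments of the standard normal distribution. -/
theorem integral_pow_add_two_gaussianReal (m : ℕ) :
    ∫ x, x ^ (m + 2) ∂(gaussianReal 0 1) = (m + 1) * ∫ x, x ^ m ∂(gaussianReal 0 1) := by
  rw [integral_pow_gaussianReal_zero_one, integral_pow_gaussianReal_zero_one, mul_left_comm]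
  congr 1
  have hu : ∀ x : ℝ, HasDerivAt (fun x : ℝ => x ^ (m + 1)) ((m + 1 : ℕ) * x ^ m) x := fun x => by
    simpa using hasDerivAt_pow (m + 1) x
  have hv : ∀ x : ℝ, HasDerivAt (fun x : ℝ => Real.exp (-(x ^ 2 / 2)))
      (-x * Real.exp (-(x ^ 2 / 2))) x := fun x => by
    have h := (((hasDerivAt_pow 2 x).div_const 2).neg).exp
    refine h.congr_deriv ?_
    simp only [Pi.neg_apply, Nat.cast_ofNat]
    ring
  -- Integration by parts, with `-x * exp (-x²/2)` as the derivative of `exp (-x²/2)`.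
  have h := integral_mul_deriv_eq_deriv_mul_of_integrable (fun x _ => hu x) (fun x _ => hv x)
    (by
      refine (integrable_pow_mul_exp_neg_sq_div_two (m + 2)).neg.congr
        (Filter.Eventually.of_forall fun x => ?_)
      simp only [Pi.neg_apply, Pi.mul_apply]
      ring)
    (by
      refine ((integrable_pow_mul_exp_neg_sq_div_two m).const_mul (m + 1 : ℕ)).congr
        (Filter.Eventually.of_forall fun x => ?_)
      simp only [Pi.mul_apply]
      ring)
    (integrable_pow_mul_exp_neg_sq_div_two (m + 1))
  calc ∫ x : ℝ, x ^ (m + 2) * Real.exp (-(x ^ 2 / 2))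
      = -∫ x : ℝ, x ^ (m + 1) * (-x * Real.exp (-(x ^ 2 / 2))) := by
        rw [← integral_neg]
        refine integral_congr_ae (Filter.Eventually.of_forall fun x => ?_)
        ring
    _ = ∫ x : ℝ, (m + 1 : ℕ) * x ^ m * Real.exp (-(x ^ 2 / 2)) := by rw [h, neg_neg]
    _ = _ := by
        rw [← integral_const_mul]
        refine integral_congr_ae (Filter.Eventually.of_forall fun x => ?_)
        push_cast
        ring

/-- The constant in the rate of convergence of normalised moments of order `2 * r`. -/
noncomputable def momentRate (K c : ℝ) : ℕ → ℝ
  | 0 => 0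
  | r + 1 => (2 * r + 1) * momentRate K c r
      + (K + (2 * (r + 1) : ℕ) * K ^ 2) * (3 * r + 2 : ℕ) ^ (2 * (2 * (r + 1))) / c ^ (r + 1)

/-- Dividing the recursion by `V^(r+1) ≥ (c n³)^(r+1)` turns its error into a multiple of `1 / n`;
the error inherited from the previous order is multiplied by `2r + 1`. -/
theorem abs_normalised_moment_sub_le {K c V n : ℝ} (hc : 0 < c) (hn : 0 < n)
    (hV : c * n ^ 3 ≤ V) (hK : 0 ≤ K) {a : ℕ → ℝ} (ha : a 0 = 1) {N : ℕ}
    (hrec : ∀ r < N, |a (r + 1) - (2 * r + 1) * (V * a r)|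
      ≤ (K + (2 * (r + 1) : ℕ) * K ^ 2) * (3 * r + 2 : ℕ) ^ (2 * (2 * (r + 1)))
        * n ^ (3 * r + 2)) :
    ∀ r ≤ N, |a r / V ^ r - ∫ x, x ^ (2 * r) ∂(gaussianReal 0 1)| ≤ momentRate K c r / n := by
  have hV0 : 0 < V := lt_of_lt_of_le (by positivity) hV
  intro r
  induction r with
  | zero => intro _; simp [ha, momentRate]
  | succ r ih =>
    intro hr
    have ih' := ih (by omega)
    have hstep := hrec r (by omega)
    set B : ℝ := (K + (2 * (r + 1) : ℕ) * K ^ 2) * (3 * r + 2 : ℕ) ^ (2 * (2 * (r + 1))) with hB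
    have hB0 : 0 ≤ B := by positivity
    set g := ∫ x, x ^ (2 * r) ∂(gaussianReal 0 1) with hg
    have hgs : ∫ x, x ^ (2 * (r + 1)) ∂(gaussianReal 0 1) = (2 * r + 1) * g := by
      rw [show 2 * (r + 1) = 2 * r + 2 by ring, integral_pow_add_two_gaussianReal]
      push_cast
      ring
    have hdecomp : a (r + 1) / V ^ (r + 1) - (2 * r + 1) * g
        = (a (r + 1) - (2 * r + 1) * (V * a r)) / V ^ (r + 1)
          + (2 * r + 1) * (a r / V ^ r - g) := by
      field_simp
      ring
    have h1 : |(a (r + 1) - (2 * r + 1) * (V * a r)) / V ^ (r + 1)| ≤ B / c ^ (r + 1) / n := by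
      rw [abs_div, abs_of_pos (pow_pos hV0 _)]
      have hpow : (c * n ^ 3) ^ (r + 1) ≤ V ^ (r + 1) :=
        pow_le_pow_left₀ (by positivity) hV _
      calc _ ≤ B * n ^ (3 * r + 2) / (c * n ^ 3) ^ (r + 1) :=
            div_le_div₀ (by positivity) hstep (by positivity) hpow
        _ = B / c ^ (r + 1) / n := by
            rw [mul_pow, ← pow_mul, show 3 * (r + 1) = 3 * r + 2 + 1 by ring, pow_succ n]
            field_simp
            ring
    have h2 : |(2 * r + 1) * (a r / V ^ r - g)| ≤ (2 * r + 1) * (momentRate K c r / n) := by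
      rw [abs_mul, abs_of_pos (by positivity : (0 : ℝ) < 2 * r + 1)]
      exact mul_le_mul_of_nonneg_left ih' (by positivity)
    rw [hgs, hdecomp]
    refine (abs_add_le _ _).trans ((add_le_add h1 h2).trans (le_of_eq ?_))
    rw [momentRate, ← hB]
    ring

/-! ### Pair families built from independent observations -/

/-- The product is at most a power of its largest factor. The resulting domination gives
integrability and a uniform bound for all mixed moments without Hölder's inequality. -/
theorem abs_prod_le_one_add_sum {ι : Type*} [Fintype ι] (y : ι → ℝ) {k : ℕ} (A : Finset ι)
    (hA : A.card ≤ k) : |∏ i ∈ A, y i| ≤ 1 + ∑ i, |y i| ^ k := by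
  have hs : 0 ≤ ∑ i, |y i| ^ k := Finset.sum_nonneg fun i _ => by positivity
  rw [Finset.abs_prod]
  rcases A.eq_empty_or_nonempty with rfl | hne
  · simpa using hs
  obtain ⟨j, hj, hmax⟩ := Finset.exists_max_image A (fun i => |y i|) hne
  have h1 : ∏ i ∈ A, |y i| ≤ |y j| ^ A.card :=
    (Finset.prod_le_prod (fun i _ => abs_nonneg _) hmax).trans_eq (Finset.prod_const _)
  rcases le_total |y j| 1 with h | h
  · exact h1.trans ((pow_le_one₀ (abs_nonneg _) h).trans (by linarith))
  · have h2 : |y j| ^ A.card ≤ |y j| ^ k := pow_le_pow_right₀ h hA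
    have h3 : |y j| ^ k ≤ ∑ i, |y i| ^ k :=
      Finset.single_le_sum (f := fun i => |y i| ^ k) (fun i _ => by positivity)
        (Finset.mem_univ j)
    linarith

theorem card_filter_fst_lt_snd (n : ℕ) :
    (Finset.univ.filter fun p : Fin n × Fin n => p.1 < p.2).card = n.choose 2 := by
  rw [Finset.card_filter, Fintype.sum_prod_type]
  have : ∀ i : Fin n, ∑ j : Fin n, (if i < j then 1 else 0) = n - 1 - (i : ℕ) := by
    intro i
    rw [← Finset.card_filter, ← Fin.card_Ioi i]
    congr 1
    ext j
    simp
  simp_rw [this]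
  rw [Fin.sum_univ_eq_sum_range (fun i => n - 1 - i) n, Finset.sum_range_reflect (fun i => i) n,
    Finset.sum_range_id, Nat.choose_two_right]

section PairFamily

variable {Ω 𝒳 : Type*} [MeasurableSpace Ω] [MeasurableSpace 𝒳] {n : ℕ}

/-- The random variables `f (X i, X j)`, `i < j`, extended by zero to all pairs of indices. -/
noncomputable def pairFamily (f : 𝒳 × 𝒳 → ℝ) (X : Fin n → Ω → 𝒳) (p : Fin n × Fin n) (ω : Ω) : ℝ :=
  if p.1 < p.2 then f (X p.1 ω, X p.2 ω) else 0

variable {P : Measure Ω} {μ : Measure 𝒳} {X : Fin n → Ω → 𝒳}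
  {f : 𝒳 × 𝒳 → ℝ}

theorem measurable_pairFamily (hX : ∀ i, Measurable (X i)) (hf : Measurable f)
    (p : Fin n × Fin n) : Measurable (pairFamily f X p) := by
  unfold pairFamily
  split_ifs
  · exact hf.comp ((hX _).prodMk (hX _))
  · exact measurable_const

/-- The two products are functions of the observations indexed by `T A` and `T B`, and these index
sets are disjoint because no edge of `A` touches an edge of `B`. -/
theorem mixedMoment_pairFamily_union (hX : ∀ i, Measurable (X i)) (hind : iIndepFun X P)
    (hf : Measurable f) {ι : Type*} [DecidableEq ι] (w : ι → Fin n × Fin n) (A B : Finset ι)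
    (hAB : ∀ i ∈ A, ∀ j ∈ B, ¬ Touches w i j) :
    mixedMoment P (pairFamily f X) w (A ∪ B)
      = mixedMoment P (pairFamily f X) w A * mixedMoment P (pairFamily f X) w B := by
  -- An edge touches itself, so the sets of edges are disjoint.
  have hdisj : Disjoint A B := Finset.disjoint_left.2 fun i hiA hiB =>
    hAB i hiA i hiB ⟨true, true, rfl⟩
  let T : Finset ι → Finset (Fin n) := fun A => (A ×ˢ Finset.univ).image (endpoints w)
  have hT : Disjoint (T A) (T B) := by
    refine Finset.disjoint_left.2 fun v hvA hvB => ?_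
    obtain ⟨⟨i, a⟩, hi, hia⟩ := Finset.mem_image.1 hvA
    obtain ⟨⟨j, b⟩, hj, hjb⟩ := Finset.mem_image.1 hvB
    exact hAB i (Finset.mem_product.1 hi).1 j (Finset.mem_product.1 hj).1
      ⟨a, b, hia.trans hjb.symm⟩
  have hmem : ∀ (A : Finset ι) (i : A) (b : Bool), endpoints w (i, b) ∈ T A := fun A i b =>
    Finset.mem_image_of_mem _ (Finset.mem_product.2 ⟨i.2, Finset.mem_univ b⟩)
  let φ : (A : Finset ι) → (T A → 𝒳) → ℝ := fun A u => ∏ i : A,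
    if (w i).1 < (w i).2 then f (u ⟨_, hmem A i true⟩, u ⟨_, hmem A i false⟩) else 0
  have hφ : ∀ A, Measurable (φ A) := by
    intro A
    refine Finset.measurable_fun_prod _ fun i _ => ?_
    split_ifs
    · exact hf.comp ((measurable_pi_apply _).prodMk (measurable_pi_apply _))
    · exact measurable_const
  have hφX : ∀ A ω, ∏ i ∈ A, pairFamily f X (w i) ω = φ A fun v => X v ω := by
    intro A ω
    rw [← Finset.prod_coe_sort]
    rfl
  have hindep := (hind.indepFun_finset (T A) (T B) hT hX).comp (hφ A) (hφ B)
  have hmeas : ∀ A, AEStronglyMeasurable (fun ω => φ A fun v : T A => X v ω) P := fun A =>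
    ((hφ A).comp (measurable_pi_lambda _ fun v => hX v)).aestronglyMeasurable
  unfold mixedMoment
  simp_rw [Finset.prod_union hdisj, hφX]
  exact hindep.integral_fun_mul_eq_mul_integral (hmeas A) (hmeas B)

variable [IsProbabilityMeasure P]

theorem map_pair_eq_prod (hX : ∀ i, Measurable (X i)) (hind : iIndepFun X P)
    (hμ : ∀ i, P.map (X i) = μ) {i j : Fin n} (hij : i ≠ j) :
    P.map (fun ω => (X i ω, X j ω)) = μ.prod μ := by
  have h := (indepFun_iff_map_prod_eq_prod_map_map (hX i).aemeasurable (hX j).aemeasurable).1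
    (hind.indepFun hij)
  rwa [hμ, hμ] at h

theorem integral_comp_pair (hX : ∀ i, Measurable (X i)) (hind : iIndepFun X P)
    (hμ : ∀ i, P.map (X i) = μ) {i j : Fin n} (hij : i ≠ j) {φ : 𝒳 × 𝒳 → ℝ} (hφ : Measurable φ) :
    ∫ ω, φ (X i ω, X j ω) ∂P = ∫ z, φ z ∂(μ.prod μ) := by
  rw [← map_pair_eq_prod hX hind hμ hij, integral_map ((hX i).prodMk (hX j)).aemeasurable
    hφ.aestronglyMeasurable]

theorem integrable_comp_pair_iff (hX : ∀ i, Measurable (X i)) (hind : iIndepFun X P)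
    (hμ : ∀ i, P.map (X i) = μ) {i j : Fin n} (hij : i ≠ j) {φ : 𝒳 × 𝒳 → ℝ} (hφ : Measurable φ) :
    Integrable (fun ω => φ (X i ω, X j ω)) P ↔ Integrable φ (μ.prod μ) := by
  rw [← map_pair_eq_prod hX hind hμ hij, integrable_map_measure hφ.aestronglyMeasurable
    ((hX i).prodMk (hX j)).aemeasurable]
  rfl

theorem integral_pairFamily (hX : ∀ i, Measurable (X i)) (hind : iIndepFun X P)
    (hμ : ∀ i, P.map (X i) = μ) (hf : Measurable f) (hf0 : ∫ z, f z ∂(μ.prod μ) = 0)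
    (p : Fin n × Fin n) : ∫ ω, pairFamily f X p ω ∂P = 0 := by
  unfold pairFamily
  split_ifs with h
  · rw [integral_comp_pair hX hind hμ h.ne hf, hf0]
  · simp

theorem integrable_abs_pairFamily_pow (hX : ∀ i, Measurable (X i)) (hind : iIndepFun X P)
    (hμ : ∀ i, P.map (X i) = μ) (hf : Measurable f) {k : ℕ}
    (hk : Integrable (fun z => |f z| ^ k) (μ.prod μ)) (p : Fin n × Fin n) :
    Integrable (fun ω => |pairFamily f X p ω| ^ k) P := by
  by_cases h : p.1 < p.2
  · simp only [pairFamily, if_pos h]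
    exact (integrable_comp_pair_iff hX hind hμ h.ne (hf.abs.pow_const k)).2 hk
  · simp only [pairFamily, if_neg h]
    exact integrable_const _

theorem integral_abs_pairFamily_pow_le (hX : ∀ i, Measurable (X i)) (hind : iIndepFun X P)
    (hμ : ∀ i, P.map (X i) = μ) (hf : Measurable f) {k : ℕ} (hk0 : k ≠ 0) {K : ℝ} (hK0 : 0 ≤ K)
    (hK : ∫ z, |f z| ^ k ∂(μ.prod μ) ≤ K) (p : Fin n × Fin n) :
    ∫ ω, |pairFamily f X p ω| ^ k ∂P ≤ K := by
  by_cases h : p.1 < p.2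
  · simp only [pairFamily, if_pos h]
    rwa [integral_comp_pair hX hind hμ h.ne (hf.abs.pow_const k) (φ := fun z => |f z| ^ k)]
  · simpa [pairFamily, if_neg h, hk0] using hK0

theorem integrable_prod_pairFamily (hX : ∀ i, Measurable (X i)) (hind : iIndepFun X P)
    (hμ : ∀ i, P.map (X i) = μ) (hf : Measurable f) {k : ℕ}
    (hk : Integrable (fun z => |f z| ^ k) (μ.prod μ)) {ι : Type*} [Fintype ι]
    (w : ι → Fin n × Fin n) (A : Finset ι) (hA : A.card ≤ k) :
    Integrable (fun ω => ∏ i ∈ A, pairFamily f X (w i) ω) P := by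
  have hdom : Integrable (fun ω => 1 + ∑ i, |pairFamily f X (w i) ω| ^ k) P :=
    (integrable_const _).add (integrable_finsetSum _ fun i _ =>
      integrable_abs_pairFamily_pow hX hind hμ hf hk (w i))
  refine hdom.mono' (Finset.measurable_fun_prod _ fun i _ =>
    measurable_pairFamily hX hf (w i)).aestronglyMeasurable ?_
  exact Filter.Eventually.of_forall fun ω => abs_prod_le_one_add_sum _ A hA

theorem abs_mixedMoment_pairFamily_le (hX : ∀ i, Measurable (X i)) (hind : iIndepFun X P)
    (hμ : ∀ i, P.map (X i) = μ) (hf : Measurable f) {k : ℕ} (hk0 : k ≠ 0)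
    (hk : Integrable (fun z => |f z| ^ k) (μ.prod μ)) {K : ℝ} (hK0 : 0 ≤ K)
    (hK : ∫ z, |f z| ^ k ∂(μ.prod μ) ≤ K) {ι : Type*} [Fintype ι]
    (w : ι → Fin n × Fin n) (A : Finset ι) (hι : Fintype.card ι ≤ k) :
    |mixedMoment P (pairFamily f X) w A| ≤ 1 + k * K := by
  have hi := integrable_abs_pairFamily_pow hX hind hμ hf hk
  have hA : A.card ≤ k := (Finset.card_le_univ A).trans hι
  calc |mixedMoment P (pairFamily f X) w A|
      ≤ ∫ ω, |∏ i ∈ A, pairFamily f X (w i) ω| ∂P := abs_integral_le_integral_abs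
    _ ≤ ∫ ω, (1 + ∑ i, |pairFamily f X (w i) ω| ^ k) ∂P :=
        integral_mono (integrable_prod_pairFamily hX hind hμ hf hk w A hA).abs
          ((integrable_const _).add (integrable_finsetSum _ fun i _ => hi (w i)))
          fun ω => abs_prod_le_one_add_sum _ A hA
    _ = 1 + ∑ i, ∫ ω, |pairFamily f X (w i) ω| ^ k ∂P := by
        rw [integral_add (integrable_const _) (integrable_finsetSum _ fun i _ => hi (w i)),
          integral_finsetSum _ fun i _ => hi (w i)]
        simp
    _ ≤ 1 + k * K := by
        refine add_le_add le_rfl ((Finset.sum_le_card_nsmul _ _ K fun i _ =>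
          integral_abs_pairFamily_pow_le hX hind hμ hf hk0 hK0 hK (w i)).trans ?_)
        rw [nsmul_eq_mul]
        exact mul_le_mul_of_nonneg_right (by exact_mod_cast hι) hK0

end PairFamily

/-! ### Lower bound for the variance -/

section Projection

variable {Ω 𝒳 : Type*} [MeasurableSpace Ω] [MeasurableSpace 𝒳] {n : ℕ}
  {P : Measure Ω} {μ : Measure 𝒳} {X : Fin n → Ω → 𝒳}
  {f : 𝒳 × 𝒳 → ℝ} {g : 𝒳 → ℝ}

theorem integral_comp_mul_comp (hX : ∀ i, Measurable (X i)) (hind : iIndepFun X P)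
    (hμ : ∀ i, P.map (X i) = μ) (hg : Measurable g) (hg0 : ∫ x, g x ∂μ = 0) (i j : Fin n) :
    ∫ ω, g (X i ω) * g (X j ω) ∂P = if j = i then ∫ x, g x ^ 2 ∂μ else 0 := by
  split_ifs with h
  · subst h
    rw [← hμ j, integral_map (hX j).aemeasurable (hg.pow_const 2).aestronglyMeasurable]
    simp_rw [sq]
  · have h1 := ((hind.indepFun (Ne.symm h)).comp hg hg).integral_fun_mul_eq_mul_integral
      (hg.comp (hX i)).aestronglyMeasurable (hg.comp (hX j)).aestronglyMeasurable
    simp only [Function.comp_apply] at h1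
    have h2 : ∫ ω, g (X i ω) ∂P = 0 := by
      rw [← hg0, ← hμ i, integral_map (hX i).aemeasurable hg.aestronglyMeasurable]
    rw [h1, h2, zero_mul]

theorem integral_sum_sum {ι κ : Type*} [Fintype ι] [Fintype κ] {F : ι → κ → Ω → ℝ}
    (hF : ∀ i j, Integrable (F i j) P) :
    ∫ ω, ∑ i, ∑ j, F i j ω ∂P = ∑ i, ∑ j, ∫ ω, F i j ω ∂P := by
  rw [integral_finsetSum _ fun i _ => integrable_finsetSum _ fun j _ => hF i j]
  exact Finset.sum_congr rfl fun i _ => integral_finsetSum _ fun j _ => hF i j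

variable [IsProbabilityMeasure P]

theorem memLp_pairFamily (hX : ∀ i, Measurable (X i)) (hind : iIndepFun X P)
    (hμ : ∀ i, P.map (X i) = μ) {q : ENNReal} (hf : MemLp f q (μ.prod μ)) (p : Fin n × Fin n) :
    MemLp (pairFamily f X p) q P := by
  by_cases h : p.1 < p.2
  · have hmp : MeasurePreserving (fun ω => (X p.1 ω, X p.2 ω)) P (μ.prod μ) :=
      ⟨(hX _).prodMk (hX _), map_pair_eq_prod hX hind hμ h.ne⟩
    refine (hf.comp_measurePreserving hmp).ae_eq (Filter.Eventually.of_forall fun ω => ?_)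
    simp [pairFamily, h]
  · have h0 : pairFamily f X p = fun _ => 0 := by
      funext ω
      simp [pairFamily, h]
    rw [h0]
    exact memLp_const 0

/-- An observation outside the pair is independent of it, so centring of `g` kills the term; the two
members of the pair each contribute `s`. -/
theorem integral_pairFamily_mul_comp (hX : ∀ i, Measurable (X i)) (hind : iIndepFun X P)
    (hμ : ∀ i, P.map (X i) = μ) (hf : Measurable f) (hg : Measurable g)
    (hg0 : ∫ x, g x ∂μ = 0) {s : ℝ} (h1 : ∫ z, f z * g z.1 ∂(μ.prod μ) = s)
    (h2 : ∫ z, f z * g z.2 ∂(μ.prod μ) = s) (p : Fin n × Fin n) (l : Fin n) :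
    ∫ ω, pairFamily f X p ω * g (X l ω) ∂P
      = if p.1 < p.2 then (if l = p.1 then s else 0) + (if l = p.2 then s else 0) else 0 := by
  by_cases h : p.1 < p.2
  · simp only [pairFamily, if_pos h]
    by_cases hl1 : l = p.1
    · subst hl1
      rw [if_pos rfl, if_neg h.ne, add_zero, ← h1]
      exact integral_comp_pair hX hind hμ h.ne (φ := fun z => f z * g z.1)
        (hf.mul (hg.comp measurable_fst))
    by_cases hl2 : l = p.2
    · subst hl2
      rw [if_pos rfl, if_neg h.ne', zero_add, ← h2]
      exact integral_comp_pair hX hind hμ h.ne (φ := fun z => f z * g z.2)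
        (hf.mul (hg.comp measurable_snd))
    · rw [if_neg hl1, if_neg hl2, add_zero]
      have hi := ((hind.indepFun_prodMk hX p.1 p.2 l (Ne.symm hl1) (Ne.symm hl2)).comp hf
        hg).integral_fun_mul_eq_mul_integral
        (hf.comp ((hX p.1).prodMk (hX p.2))).aestronglyMeasurable
        (hg.comp (hX l)).aestronglyMeasurable
      simp only [Function.comp_apply] at hi
      have h0 : ∫ ω, g (X l ω) ∂P = 0 := by
        rw [← hg0, ← hμ l, integral_map (hX l).aemeasurable hg.aestronglyMeasurable]
      rw [hi, h0, mul_zero]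
  · simp [pairFamily, h]

/-- The second moment of the sum is at least that of its projection on sums of functions of
single observations. -/
theorem le_integral_sum_pairFamily_sq (hX : ∀ i, Measurable (X i)) (hind : iIndepFun X P)
    (hμ : ∀ i, P.map (X i) = μ) (hf : Measurable f) (hf2 : MemLp f 2 (μ.prod μ))
    (hg : Measurable g) (hg2 : MemLp g 2 μ) (hg0 : ∫ x, g x ∂μ = 0) {s : ℝ}
    (hgs : ∫ x, g x ^ 2 ∂μ = s) (h1 : ∫ z, f z * g z.1 ∂(μ.prod μ) = s)
    (h2 : ∫ z, f z * g z.2 ∂(μ.prod μ) = s) :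
    n * (n - 1) ^ 2 * s ≤ ∫ ω, (∑ p, pairFamily f X p ω) ^ 2 ∂P := by
  have hY := memLp_pairFamily hX hind hμ hf2
  have hG : ∀ l, MemLp (fun ω => g (X l ω)) 2 P := fun l =>
    hg2.comp_measurePreserving ⟨hX l, hμ l⟩
  have hS : MemLp (fun ω => ∑ p, pairFamily f X p ω) 2 P := memLp_finsetSum _ fun p _ => hY p
  have hT : MemLp (fun ω => ∑ l, g (X l ω)) 2 P := memLp_finsetSum _ fun l _ => hG l
  have hTT : ∫ ω, (∑ l, g (X l ω)) ^ 2 ∂P = n * s := by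
    simp_rw [sq, Finset.sum_mul_sum]
    rw [integral_sum_sum (F := fun i j ω => g (X i ω) * g (X j ω)) fun i j => (hG i).integrable_mul (hG j)]
    simp [integral_comp_mul_comp hX hind hμ hg hg0, hgs]
  have hST : ∫ ω, (∑ p, pairFamily f X p ω) * ∑ l, g (X l ω) ∂P = n * (n - 1) * s := by
    simp_rw [Finset.sum_mul_sum]
    rw [integral_sum_sum (F := fun p l ω => pairFamily f X p ω * g (X l ω)) fun p l =>
      (hY p).integrable_mul (hG l)]
    simp_rw [integral_pairFamily_mul_comp hX hind hμ hf hg hg0 h1 h2]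
    have : ∀ p : Fin n × Fin n, ∑ l : Fin n, (if p.1 < p.2 then
        (if l = p.1 then s else 0) + (if l = p.2 then s else 0) else 0)
        = if p.1 < p.2 then 2 * s else 0 := by
      intro p
      split_ifs
      · simp [Finset.sum_add_distrib, two_mul]
      · simp
    simp_rw [this]
    rw [← Finset.sum_filter, Finset.sum_const, card_filter_fst_lt_snd, nsmul_eq_mul,
      Nat.cast_choose_two]
    ring
  -- The coefficient `n - 1` is the number of pairs containing a given index. With `𝔼 T² = n s` and
  -- `𝔼 S T = n (n-1) s`, the expanded square is `𝔼 S² - n (n-1)² s`.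
  have hnn : 0 ≤ ∫ ω, ((∑ p, pairFamily f X p ω) - (n - 1) * ∑ l, g (X l ω)) ^ 2 ∂P :=
    integral_nonneg fun ω => sq_nonneg _
  have hexp : ∫ ω, ((∑ p, pairFamily f X p ω) - (n - 1) * ∑ l, g (X l ω)) ^ 2 ∂P
      = ∫ ω, (∑ p, pairFamily f X p ω) ^ 2 ∂P
        - 2 * (n - 1) * ∫ ω, (∑ p, pairFamily f X p ω) * ∑ l, g (X l ω) ∂P
        + (n - 1) ^ 2 * ∫ ω, (∑ l, g (X l ω)) ^ 2 ∂P := by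
    have hi1 := hS.integrable_sq
    have hi2 : Integrable (fun ω => 2 * ((n : ℝ) - 1) *
        ((∑ p, pairFamily f X p ω) * ∑ l, g (X l ω))) P :=
      (hS.integrable_mul hT).const_mul _
    have hi3 := hT.integrable_sq.const_mul (((n : ℝ) - 1) ^ 2)
    have hi12 : Integrable (fun ω => (∑ p, pairFamily f X p ω) ^ 2 - 2 * ((n : ℝ) - 1) *
        ((∑ p, pairFamily f X p ω) * ∑ l, g (X l ω))) P := hi1.sub hi2
    rw [← integral_const_mul, ← integral_const_mul, ← integral_sub hi1 hi2,
      ← integral_add hi12 hi3]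
    refine integral_congr_ae (Filter.Eventually.of_forall fun ω => ?_)
    ring
  rw [hexp, hST, hTT] at hnn
  linarith

end Projection

/-! ### Centring the kernel and standardising -/

section Kernel

variable {𝒳 : Type*} [MeasurableSpace 𝒳] {μ : Measure 𝒳} [IsProbabilityMeasure μ]

/-- Bounds for the moments of a centred random variable in terms of absolute moments. -/
theorem integral_abs_sub_integral_pow_le {φ : 𝒳 → ℝ} (hφ : Measurable φ) {k : ℕ}
    (h3 : Integrable (fun x => |φ x| ^ 3) μ) (hk : Integrable (fun x => |φ x| ^ k) μ) {a b : ℝ}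
    (ha : ∫ x, |φ x| ^ 3 ∂μ ≤ a) (hb : ∫ x, |φ x| ^ k ∂μ ≤ b) :
    Integrable φ μ ∧ Integrable (fun x => |φ x - ∫ y, φ y ∂μ| ^ k) μ ∧
      ∫ x, |φ x - ∫ y, φ y ∂μ| ^ k ∂μ ≤ 2 ^ (k - 1) * (b + (1 + a) ^ k) := by
  -- Only absolute moments of orders 3 and `k` are available, so the mean is controlled through the
  -- third one.
  have hle : ∀ x, |φ x| ≤ 1 + |φ x| ^ 3 := by
    intro x
    rcases le_total |φ x| 1 with h | h
    · have : 0 ≤ |φ x| ^ 3 := by positivity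
      linarith
    · have := le_self_pow₀ h (n := 3) (by norm_num)
      linarith
  have hint : Integrable φ μ := ((integrable_const (1 : ℝ)).add h3).mono'
    hφ.aestronglyMeasurable (Filter.Eventually.of_forall hle)
  have hmean : |∫ y, φ y ∂μ| ≤ 1 + a :=
    calc |∫ y, φ y ∂μ| ≤ ∫ y, |φ y| ∂μ := abs_integral_le_integral_abs
      _ ≤ ∫ y, (1 + |φ y| ^ 3) ∂μ := integral_mono hint.abs ((integrable_const _).add h3) hle
      _ = 1 + ∫ y, |φ y| ^ 3 ∂μ := by
          rw [integral_add (integrable_const _) h3]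
          simp
      _ ≤ 1 + a := by linarith
  set θ := ∫ y, φ y ∂μ
  have hpt : ∀ x, |φ x - θ| ^ k ≤ 2 ^ (k - 1) * (|φ x| ^ k + (1 + a) ^ k) := fun x =>
    calc |φ x - θ| ^ k ≤ (|φ x| + |θ|) ^ k :=
          pow_le_pow_left₀ (abs_nonneg _) (abs_sub _ _) k
      _ ≤ 2 ^ (k - 1) * (|φ x| ^ k + |θ| ^ k) := add_pow_le (abs_nonneg _) (abs_nonneg _) k
      _ ≤ 2 ^ (k - 1) * (|φ x| ^ k + (1 + a) ^ k) := by gcongr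
  have hdom : Integrable (fun x => 2 ^ (k - 1) * (|φ x| ^ k + (1 + a) ^ k)) μ :=
    (hk.add (integrable_const _)).const_mul _
  have hik : Integrable (fun x => |φ x - θ| ^ k) μ := by
    refine hdom.mono' ((hφ.sub_const θ).abs.pow_const k).aestronglyMeasurable
      (Filter.Eventually.of_forall fun x => ?_)
    rw [Real.norm_of_nonneg (by positivity)]
    exact hpt x
  refine ⟨hint, hik, (integral_mono hik hdom hpt).trans ?_⟩
  rw [integral_const_mul, integral_add hk (integrable_const _)]
  simp only [integral_const, probReal_univ, one_smul]
  gcongr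

theorem integral_projection {φ : 𝒳 × 𝒳 → ℝ} (hint : Integrable φ (μ.prod μ)) :
    ∫ x, (∫ y, φ (x, y) ∂μ - ∫ z, φ z ∂(μ.prod μ)) ∂μ = 0 := by
  rw [integral_sub hint.integral_prod_left (integrable_const _), ← integral_prod φ hint]
  simp

/-- Integrating out the second coordinate first turns the centred kernel into its own projection,
which then appears squared. -/
theorem integral_centred_mul_projection {φ : 𝒳 × 𝒳 → ℝ} (hint : Integrable φ (μ.prod μ))
    {θ : ℝ} (hf : MemLp (fun z => φ z - θ) 2 (μ.prod μ))
    (hg : MemLp (fun x => ∫ y, φ (x, y) ∂μ - θ) 2 μ) :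
    ∫ z, (φ z - θ) * (∫ y, φ (z.1, y) ∂μ - θ) ∂(μ.prod μ)
      = ∫ x, (∫ y, φ (x, y) ∂μ - θ) ^ 2 ∂μ := by
  have hprod : Integrable (fun z : 𝒳 × 𝒳 => (φ z - θ) * (∫ y, φ (z.1, y) ∂μ - θ))
      (μ.prod μ) := hf.integrable_mul (hg.comp_measurePreserving measurePreserving_fst)
  rw [integral_prod _ hprod]
  refine integral_congr_ae ?_
  filter_upwards [hint.prod_right_ae] with x hx
  rw [integral_mul_const, integral_sub hx (integrable_const _), sq]
  simp

theorem integral_centred_mul_projection_snd {φ : 𝒳 × 𝒳 → ℝ} (hsymm : ∀ z, φ z.swap = φ z)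
    (hint : Integrable φ (μ.prod μ))
    {θ : ℝ} (hf : MemLp (fun z => φ z - θ) 2 (μ.prod μ))
    (hg : MemLp (fun x => ∫ y, φ (x, y) ∂μ - θ) 2 μ) :
    ∫ z, (φ z - θ) * (∫ y, φ (z.2, y) ∂μ - θ) ∂(μ.prod μ)
      = ∫ x, (∫ y, φ (x, y) ∂μ - θ) ^ 2 ∂μ := by
  rw [← integral_centred_mul_projection hint hf hg, ← integral_prod_swap]
  simp [hsymm]

theorem memLp_two_of_integrable_abs_pow {f : 𝒳 → ℝ} (hf : Measurable f) {k : ℕ} (hk : 2 ≤ k)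
    (hi : Integrable (fun x => |f x| ^ k) μ) : MemLp f 2 μ := by
  rw [memLp_two_iff_integrable_sq hf.aestronglyMeasurable]
  refine ((integrable_const (1 : ℝ)).add hi).mono' (hf.pow_const 2).aestronglyMeasurable
    (Filter.Eventually.of_forall fun x => ?_)
  rw [Real.norm_of_nonneg (sq_nonneg _), ← sq_abs]
  simp only [Pi.add_apply]
  have h0 : 0 ≤ |f x| ^ k := by positivity
  rcases le_total |f x| 1 with h | h
  · have := pow_le_one₀ (n := 2) (abs_nonneg _) h
    linarith
  · have := pow_le_pow_right₀ h hk
    linarith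

theorem variance_const_mul_add_const {S : 𝒳 → ℝ} (hS : Integrable S μ) (hS0 : ∫ x, S x ∂μ = 0)
    (b θ : ℝ) : variance (fun x => b * S x + θ) μ = b ^ 2 * ∫ x, S x ^ 2 ∂μ := by
  have hU : ∫ x, (b * S x + θ) ∂μ = θ := by
    rw [integral_add (hS.const_mul b) (integrable_const _), integral_const_mul, hS0]
    simp
  have hmeas : AEMeasurable (fun x => b * S x + θ) μ :=
    ((hS.const_mul b).add (integrable_const θ)).aemeasurable
  rw [variance_eq_integral hmeas, hU, ← integral_const_mul]
  refine integral_congr_ae (Filter.Eventually.of_forall fun x => ?_)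
  simp only
  ring

/-- Standardisation is invariant under increasing affine maps, so the normalising factor and the
mean of the U-statistic drop out. -/
theorem standardised_const_mul_add_const {S : 𝒳 → ℝ} (hS : Integrable S μ)
    (hS0 : ∫ x, S x ∂μ = 0) {b : ℝ} (hb : 0 < b) (θ : ℝ) (x : 𝒳) :
    standardised (fun x => b * S x + θ) μ x = S x / √(∫ x, S x ^ 2 ∂μ) := by
  have hU : ∫ x, (b * S x + θ) ∂μ = θ := by
    rw [integral_add (hS.const_mul b) (integrable_const _), integral_const_mul, hS0]
    simp
  rw [standardised, variance_const_mul_add_const hS hS0, hU, Real.sqrt_mul (sq_nonneg b),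
    Real.sqrt_sq hb.le, add_sub_cancel_right, mul_div_mul_left _ _ hb.ne']

end Kernel

/-! ### Assembly for U-statistics -/

theorem uStatistic_eq_sum_pairFamily {Ω 𝒳 : Type*} {n : ℕ} (h : 𝒳 → 𝒳 → ℝ) (X : Fin n → Ω → 𝒳) (θ : ℝ)
    (hn : 2 ≤ n) :
    uStatistic h X = fun ω => ((n.choose 2 : ℕ) : ℝ)⁻¹ *
      (∑ p, pairFamily (fun z => Function.uncurry h z - θ) X p ω) + θ := by
  funext ω
  have hb : ((n.choose 2 : ℕ) : ℝ) ≠ 0 := by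
    exact_mod_cast (Nat.choose_pos hn).ne'
  unfold uStatistic pairFamily
  rw [← Finset.sum_filter, Finset.sum_sub_distrib, Finset.sum_const, card_filter_fst_lt_snd,
    nsmul_eq_mul, mul_sub, inv_mul_cancel_left₀ hb, sub_add_cancel]
  rfl

/-- The convergence rate of even moments for pair families with a nondegenerate projection. -/
theorem abs_moment_pairFamily_sub_le {Ω 𝒳 : Type*} [MeasurableSpace Ω] [MeasurableSpace 𝒳]
    {P : Measure Ω} [IsProbabilityMeasure P] {n : ℕ} (hn : 0 < n) {μ : Measure 𝒳}
    {X : Fin n → Ω → 𝒳} {f : 𝒳 × 𝒳 → ℝ} (hX : ∀ i, Measurable (X i)) (hind : iIndepFun X P)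
    (hμ : ∀ i, P.map (X i) = μ) (hf : Measurable f) (hf0 : ∫ z, f z ∂(μ.prod μ) = 0)
    {N : ℕ} (hN : N ≠ 0) (hk : Integrable (fun z => |f z| ^ (2 * N)) (μ.prod μ)) {K : ℝ}
    (hK0 : 0 ≤ K) (hK : ∫ z, |f z| ^ (2 * N) ∂(μ.prod μ) ≤ K) {c : ℝ} (hc : 0 < c)
    (hV : c * n ^ 3 ≤ ∫ ω, (∑ p, pairFamily f X p ω) ^ 2 ∂P) :
    |(∫ ω, (∑ p, pairFamily f X p ω) ^ (2 * N) ∂P)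
        / (∫ ω, (∑ p, pairFamily f X p ω) ^ 2 ∂P) ^ N - ∫ x, x ^ (2 * N) ∂(gaussianReal 0 1)|
      ≤ momentRate (1 + (2 * N : ℕ) * K) c N / n := by
  refine abs_normalised_moment_sub_le (n := n)
    (a := fun r => ∫ ω, (∑ p, pairFamily f X p ω) ^ (2 * r) ∂P) hc (by exact_mod_cast hn) hV
    (by positivity) (by simp) (fun r hr => ?_) N le_rfl
  -- Each recursion step involves at most `2 * N` factors, so the moment of order `2 * N` suffices
  -- throughout.
  have hcard : ∀ A : Finset (Fin (2 * (r + 1))), A.card ≤ 2 * N := fun A =>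
    (Finset.card_le_univ A).trans (by rw [Fintype.card_fin]; omega)
  refine abs_integral_sum_pow_sub_le hn ?_ ?_ ?_ ?_
  · exact fun w A => integrable_prod_pairFamily hX hind hμ hf hk w A (hcard A)
  · exact fun w A => abs_mixedMoment_pairFamily_le hX hind hμ hf (by omega) hk hK0 hK w A
      (by rw [Fintype.card_fin]; omega)
  · intro w i
    simp only [mixedMoment, Finset.prod_singleton]
    exact integral_pairFamily hX hind hμ hf hf0 (w i)
  · exact fun w A B hAB => mixedMoment_pairFamily_union hX hind hf w A B hAB

theorem integrable_sum_pairFamily_pow {Ω 𝒳 : Type*} [MeasurableSpace Ω] [MeasurableSpace 𝒳]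
    {P : Measure Ω} [IsProbabilityMeasure P] {n : ℕ} {μ : Measure 𝒳}
    {X : Fin n → Ω → 𝒳} {f : 𝒳 × 𝒳 → ℝ} (hX : ∀ i, Measurable (X i)) (hind : iIndepFun X P)
    (hμ : ∀ i, P.map (X i) = μ) (hf : Measurable f) {k : ℕ}
    (hk : Integrable (fun z => |f z| ^ k) (μ.prod μ)) :
    Integrable (fun ω => (∑ p, pairFamily f X p ω) ^ k) P := by
  simp_rw [Fintype.sum_pow]
  exact integrable_finsetSum _ fun w _ =>
    integrable_prod_pairFamily hX hind hμ hf hk w Finset.univ (by simp)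

theorem mainTheorem8 (k : ℕ) (hk : Even k) (hk4 : 4 ≤ k)
    (γ C σ₁ : ℝ) (hγ : 1 ≤ γ) (hC : 0 < C) (hσ₁ : 0 < σ₁) :
    ∃ C₁ : ℝ, ∀ (Ω : Type*) (𝒳 : Type*) [MeasurableSpace Ω] [MeasurableSpace 𝒳]
      (P : Measure Ω) [IsProbabilityMeasure P]
      (n : ℕ) (hn : 2 ≤ n) (X : Fin n → Ω → 𝒳) (h : 𝒳 → 𝒳 → ℝ),
      (∀ i, Measurable (X i)) →
      iIndepFun X P →
      (∀ i j, IdentDistrib (X i) (X j) P P) →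
      Measurable (Function.uncurry h) →
      (∀ x y, h x y = h y x) →
      (∀ j : ℕ, 3 ≤ j →
        Integrable (fun ω => |h (X ⟨0, by omega⟩ ω) (X ⟨1, by omega⟩ ω)| ^ j) P ∧
        ∫ ω, |h (X ⟨0, by omega⟩ ω) (X ⟨1, by omega⟩ ω)| ^ j ∂P
          ≤ C ^ j * (j.factorial : ℝ) ^ γ) →
      variance (fun ω => kernelProjection h (X ⟨1, by omega⟩) P (X ⟨0, by omega⟩ ω)) P
        = σ₁ ^ 2 →
      0 < variance (uStatistic h X) P ∧
      Integrable (fun ω => standardised (uStatistic h X) P ω ^ k) P ∧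
      |(∫ ω, standardised (uStatistic h X) P ω ^ k ∂P) - ∫ x, x ^ k ∂(gaussianReal 0 1)|
        ≤ C₁ / n := by
  obtain ⟨N, rfl⟩ := hk.exists_two_nsmul
  rw [smul_eq_mul] at hk4 ⊢
  -- `B` bounds the centred absolute moment of order `2N`, using the hypothesis at orders `3` (for
  -- the mean) and `2N`.
  set B : ℝ := 2 ^ (2 * N - 1) * (C ^ (2 * N) * ((2 * N).factorial : ℝ) ^ γ
    + (1 + C ^ 3 * (Nat.factorial 3 : ℝ) ^ γ) ^ (2 * N)) with hB
  have hB0 : 0 ≤ B := by positivity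
  refine ⟨momentRate (1 + (2 * N : ℕ) * B) (σ₁ ^ 2 / 4) N, ?_⟩
  intro Ω 𝒳 _ _ P _ n hn X h hX hind hid hh hsymm hmom hvar
  set i₀ : Fin n := ⟨0, by omega⟩
  set i₁ : Fin n := ⟨1, by omega⟩
  have hne : i₀ ≠ i₁ := by simp [i₀, i₁]
  obtain ⟨μ, hμ⟩ : ∃ μ, ∀ i, P.map (X i) = μ := ⟨P.map (X i₀), fun i => (hid i i₀).map_eq⟩
  have hμp : IsProbabilityMeasure μ := by
    rw [← hμ i₀]
    exact Measure.isProbabilityMeasure_map (hX i₀).aemeasurable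
  set φ := Function.uncurry h with hφ
  have hmom' : ∀ j : ℕ, 3 ≤ j → Integrable (fun z => |φ z| ^ j) (μ.prod μ) ∧
      ∫ z, |φ z| ^ j ∂(μ.prod μ) ≤ C ^ j * (j.factorial : ℝ) ^ γ := by
    intro j hj
    have hm : Measurable fun z => |φ z| ^ j := hh.abs.pow_const j
    rw [← integrable_comp_pair_iff hX hind hμ hne hm, ← integral_comp_pair hX hind hμ hne hm]
    exact hmom j hj
  obtain ⟨hint, hik, hK⟩ := integral_abs_sub_integral_pow_le hh (hmom' 3 le_rfl).1
    (hmom' (2 * N) (by omega)).1 (hmom' 3 le_rfl).2 (hmom' (2 * N) (by omega)).2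
  rw [← hB] at hK
  set θ := ∫ z, φ z ∂(μ.prod μ) with hθ
  have hf : Measurable fun z => φ z - θ := hh.sub_const θ
  have hf0 : ∫ z, (φ z - θ) ∂(μ.prod μ) = 0 := by
    rw [integral_sub hint (integrable_const _)]
    simp [hθ]
  have hf2 : MemLp (fun z => φ z - θ) 2 (μ.prod μ) :=
    memLp_two_of_integrable_abs_pow hf (by omega) hik
  have hproj : Measurable fun x => ∫ y, φ (x, y) ∂μ :=
    (hh.stronglyMeasurable.integral_prod_right').measurable
  have hkp : ∀ x, kernelProjection h (X i₁) P x = ∫ y, φ (x, y) ∂μ := by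
    intro x
    have hm : Measurable fun y => φ (x, y) := hh.comp measurable_prodMk_left
    rw [kernelProjection, ← hμ i₁, integral_map (hX i₁).aemeasurable hm.aestronglyMeasurable]
    rfl
  simp_rw [hkp] at hvar
  have hmap := variance_map hproj.aemeasurable (hX i₀).aemeasurable (μ := P)
  rw [hμ i₀] at hmap
  replace hvar := hmap.trans hvar
  -- `variance` is zero for functions outside `L²`, so the positive value `σ₁ ^ 2` makes the
  -- projection square integrable.
  have hg2 : MemLp (fun x => ∫ y, φ (x, y) ∂μ - θ) 2 μ :=
    (memLp_two_of_variance_ne_zero hproj.aestronglyMeasurable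
      (by rw [hvar]; positivity)).sub (memLp_const θ)
  have hgs : ∫ x, (∫ y, φ (x, y) ∂μ - θ) ^ 2 ∂μ = σ₁ ^ 2 := by
    rw [← hvar, variance_eq_integral hproj.aemeasurable, ← integral_prod φ hint]
  have hlow := le_integral_sum_pairFamily_sq hX hind hμ hf hf2 (hproj.sub_const θ) hg2
    (integral_projection hint) hgs
    ((integral_centred_mul_projection hint hf2 hg2).trans hgs)
    ((integral_centred_mul_projection_snd (fun z => hsymm z.2 z.1) hint hf2 hg2).trans hgs)
  have hn2 : (2 : ℝ) ≤ n := by exact_mod_cast hn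
  have hV : σ₁ ^ 2 / 4 * (n : ℝ) ^ 3
      ≤ ∫ ω, (∑ p, pairFamily (fun z => φ z - θ) X p ω) ^ 2 ∂P := by
    refine le_trans ?_ hlow
    -- Since `n ≥ 2`, `n - 1 ≥ n / 2`; this is where the factor `1 / 4` comes from.
    have h1 : ((n : ℝ) / 2) ^ 2 ≤ (n - 1) ^ 2 := pow_le_pow_left₀ (by positivity) (by linarith) 2
    calc σ₁ ^ 2 / 4 * (n : ℝ) ^ 3 = n * ((n : ℝ) / 2) ^ 2 * σ₁ ^ 2 := by ring
      _ ≤ n * ((n : ℝ) - 1) ^ 2 * σ₁ ^ 2 := by gcongr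
  have hVpos : 0 < ∫ ω, (∑ p, pairFamily (fun z => φ z - θ) X p ω) ^ 2 ∂P :=
    lt_of_lt_of_le (by positivity) hV
  have hSint : Integrable (fun ω => ∑ p, pairFamily (fun z => φ z - θ) X p ω) P :=
    integrable_finsetSum _ fun p _ => (memLp_pairFamily hX hind hμ hf2 p).integrable (by norm_num)
  have hS0 : ∫ ω, ∑ p, pairFamily (fun z => φ z - θ) X p ω ∂P = 0 := by
    rw [integral_finsetSum _ fun p _ =>
      (memLp_pairFamily hX hind hμ hf2 p).integrable (by norm_num)]
    exact Finset.sum_eq_zero fun p _ => integral_pairFamily hX hind hμ hf hf0 p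
  have hb : (0 : ℝ) < ((n.choose 2 : ℕ) : ℝ)⁻¹ :=
    inv_pos.2 (by exact_mod_cast Nat.choose_pos hn)
  -- The even power removes the square root: `(√V) ^ (2 * N) = V ^ N`.
  have hZ : ∀ ω, standardised (uStatistic h X) P ω ^ (2 * N)
      = (∑ p, pairFamily (fun z => φ z - θ) X p ω) ^ (2 * N)
        / (∫ ω, (∑ p, pairFamily (fun z => φ z - θ) X p ω) ^ 2 ∂P) ^ N := by
    intro ω
    rw [uStatistic_eq_sum_pairFamily h X θ hn, standardised_const_mul_add_const hSint hS0 hb, div_pow,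
      pow_mul (√_), Real.sq_sqrt hVpos.le]
  have hSk := integrable_sum_pairFamily_pow hX hind hμ hf hik
  refine ⟨?_, ?_, ?_⟩
  · rw [uStatistic_eq_sum_pairFamily h X θ hn, variance_const_mul_add_const hSint hS0]
    positivity
  · simp_rw [hZ]
    exact hSk.div_const _
  · simp_rw [hZ]
    rw [integral_div]
    exact abs_moment_pairFamily_sub_le (by omega) hX hind hμ hf hf0 (by omega) hik hB0 hK
      (by positivity) hV
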